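/- Consider the untyped call-by-value $\lambda$-calculus with shift and reset, with terms $t ::= x \mid \lambda x.t \mid t\,t \mid \mathcal{S}k.t \mid \langle t\rangle$ (up to $\alpha$-conversion; $\lambda x$ and $\mathcal{S}k$ are binders), values $v ::= \lambda x.t \mid x$, pure contexts $E ::= \square \mid v\,E \mid E\,t$ and evaluation contexts $F ::= \square \mid v\,F \mid F\,t \mid \langle F\rangle$. Reduction is given by $F[(\lambda x.t)\,v] \to F[t\{v/x\}]$, by $F[\langle E[\mathcal{S}k.t]\rangle] \to F[\langle t\{\lambda x.\langle E[x]\rangle/k\}\rangle]$ with $x\notin \mathrm{fv}(E)$, and by $F[\langle v\rangle] \to F[v]$; we write $t \Downarrow t'$ if $t \to^* t'$ and $t' \not\to$. Let $x \star y = x\,y$ and $(\lambda x.t)\star y = t\{y/x\}$. A relation $R$ on terms is extended to evaluation contexts as follows: $F_0 \mathrel{R} F_1$ if either $F_i = F_i'[\langle E_i\rangle]$ ($i=0,1$) with $E_i$ pure, $F_0'[x] \mathrel R F_1'[x]$ and $\langle E_0[x]\rangle \mathrel R \langle E_1[x]\rangle$ for a fresh $x$, or both $F_0$, $F_1$ are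 pure and $F_0[x] \mathrel R F_1[x]$ for a fresh $x$. The relation $R^{\mathrm{nf}}$ is defined inductively by: $v_0 \mathrel{R^{\mathrm{nf}}} v_1$ if $v_0\star x \mathrel R v_1 \star x$ for a fresh $x$; $F_0[x\,v_0] \mathrel{R^{\mathrm{nf}}} F_1[x\,v_1]$ if $F_0 \mathrel R F_1$ and $v_0 \mathrel{R^{\mathrm{nf}}} v_1$; and $E_0[\mathcal{S}k.t_0] \mathrel{R^{\mathrm{nf}}} E_1[\mathcal{S}k.t_1]$ if $E_0 \mathrel R E_1$ and $\langle t_0\rangle \mathrel R \langle t_1\rangle$. The relation $R^{\mathrm{rnf}}$ is defined in the same way, except that the last rule becomes: $E_0[\mathcal{S}k.t_0] \mathrel{R^{\mathrm{rnf}}} E_1[\mathcal{S}k.t_1]$ if $\langle t_0\{\lambda x.\langle k'\,E_0[x]\rangle/k\}\rangle \mathrel R \langle t_1\{\lambda x.\langle k'\,E_1[x]\rangle/k\}\rangle$ for distinct fresh $k'$, $x$. A relation $R$ is a normal form simulation if $t_0 \mathrel R t_1$ and $t_0 \Downarrow t_0'$ imply $t_1\Downarrow t_1'$ for some $t_1'$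 with $t_0' \mathrel{R^{\mathrm{nf}}} t_1'$; it is a normal form bisimulation if $R$ and $R^{-1}$ are normal form simulations. Normal form bisimilarity $\approx$ is the largest normal form bisimulation, and refined normal form bisimilarity $\approx_r$ is obtained in the same way from $R^{\mathrm{rnf}}$. Then for every pure context $E$, every term $t$ and all variables $k$, $k'$, $x$ such that $k' \notin \mathrm{fv}(E)\cup\mathrm{fv}(t)$, $x\notin\mathrm{fv}(E)$ and $x \neq k'$, $$E[\mathcal{S}k.t] \approx_r \mathcal{S}k'.\,t\{\lambda x.\langle k'\,E[x]\rangle/k\}.$$ This fails for plain bisimilarity: if $\Omega = (\lambda x.x\,x)\,(\lambda x.x\,x)$ and $E = (\lambda z.\Omega)\,\square$, then for every term $t$ and all variables $k$, $k'$, $x$ with $k'\notin\mathrm{fv}(t)$ and $x\neq k'$, $$E[\mathcal{S}k.t] \not\approx \mathcal{S}k'.\,t\{\lambda x.\langle k'\,E[x]\rangle/k\}.$$ -/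

import Mathlib

/-!
The untyped call-by-value lambda-calculus with the delimited-control operators shift and reset,
its normal form bisimilarity and its refined normal form bisimilarity.

Term variables are natural numbers. Terms are taken up to alpha-conversion by representing bound
variables with de Bruijn indices: under `d` binders the indices below `d` are bound, and the index
`n + d` is the free variable named `n`. The operations `Tm.Lam x t` and `Tm.Shift k t` build the
named abstractions `λx.t` and `Sk.t`.
-/

namespace ShiftReset

/-- Terms up to alpha-conversion. `lam` and `shift` bind the index `0` of their argument. -/
inductive Tm : Type
  | var (n : ℕ) : Tm
  | lam (b : Tm) : Tm
  | app (t u : Tm) : Tm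
  | shift (b : Tm) : Tm
  | reset (t : Tm) : Tm

namespace Tm

/-- The set of (names of) free variables. -/
def fv : Tm → Set ℕ
  | var n => {n}
  | lam b => {n | n + 1 ∈ b.fv}
  | app t u => t.fv ∪ u.fv
  | shift b => {n | n + 1 ∈ b.fv}
  | reset t => t.fv

/-- Extension of a renaming under a binder. -/
def upRen (ξ : ℕ → ℕ) : ℕ → ℕ
  | 0 => 0
  | n + 1 => ξ n + 1

/-- Capture-avoiding renaming of the free variables. -/
def rename (ξ : ℕ → ℕ) : Tm → Tm
  | var n => var (ξ n)
  | lam b => lam (b.rename (upRen ξ))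
  | app t u => app (t.rename ξ) (u.rename ξ)
  | shift b => shift (b.rename (upRen ξ))
  | reset t => reset (t.rename ξ)

/-- Extension of a substitution under a binder. -/
def up (σ : ℕ → Tm) : ℕ → Tm
  | 0 => var 0
  | n + 1 => (σ n).rename Nat.succ

/-- Capture-avoiding simultaneous substitution. -/
def bind (σ : ℕ → Tm) : Tm → Tm
  | var n => σ n
  | lam b => lam (b.bind (up σ))
  | app t u => app (t.bind σ) (u.bind σ)
  | shift b => shift (b.bind (up σ))
  | reset t => reset (t.bind σ)

/-- Capture-avoiding substitution `t{u/x}` of `u` for the free variable `x` in `t`. -/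
def subst (t : Tm) (x : ℕ) (u : Tm) : Tm :=
  t.bind (fun n => if n = x then u else var n)

/-- Instantiation of the bound variable of a body: if `λx.t` is `lam b`, or if `Sx.t` is `shift b`,
then `b.inst u` is `t{u/x}`. -/
def inst (b u : Tm) : Tm :=
  b.bind (fun n => match n with
    | 0 => u
    | m + 1 => var m)

/-- The body obtained from `t` by binding the free variable `x`. -/
def abstr (x : ℕ) (t : Tm) : Tm :=
  t.rename (fun n => if n = x then 0 else n + 1)

/-- The named abstraction `λx.t`. -/
def Lam (x : ℕ) (t : Tm) : Tm := lam (abstr x t)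

/-- The named control operator `Sk.t`. -/
def Shift (k : ℕ) (t : Tm) : Tm := shift (abstr k t)

/-- The diverging term `Ω = (λx.x x) (λx.x x)`. -/
def Omega : Tm :=
  app (Lam 0 (app (var 0) (var 0))) (Lam 0 (app (var 0) (var 0)))

end Tm

/-- Values: variables and abstractions. -/
inductive Value : Type
  | var (n : ℕ) : Value
  | lam (b : Tm) : Value

/-- A value as a term. -/
def Value.toTm : Value → Tm
  | .var n => .var n
  | .lam b => .lam b

/-- The application of a value to a variable: it is `x y` on a variable `x`, and `t{y/x}` on an
abstraction `λx.t`. -/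
def Value.appVal : Value → ℕ → Tm
  | .var x, y => .app (.var x) (.var y)
  | .lam b, y => b.inst (.var y)

/-- Call-by-value evaluation contexts `F ::= □ | v F | F t | ⟨F⟩`. -/
inductive EvalCtx : Type
  | hole : EvalCtx
  | appR (v : Value) (F : EvalCtx) : EvalCtx
  | appL (F : EvalCtx) (t : Tm) : EvalCtx
  | reset (F : EvalCtx) : EvalCtx

namespace EvalCtx

/-- Pure contexts `E ::= □ | v E | E t`: no reset encloses the hole. -/
def IsPure : EvalCtx → Prop
  | hole => True
  | appR _ F => F.IsPure
  | appL F _ => F.IsPure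
  | reset _ => False

/-- Filling a context with a term. -/
def fill : EvalCtx → Tm → Tm
  | hole, t => t
  | appR v F, t => .app v.toTm (F.fill t)
  | appL F u, t => .app (F.fill t) u
  | reset F, t => .reset (F.fill t)

/-- Filling a context with a context. -/
def comp : EvalCtx → EvalCtx → EvalCtx
  | hole, G => G
  | appR v F, G => appR v (F.comp G)
  | appL F u, G => appL (F.comp G) u
  | reset F, G => reset (F.comp G)

/-- The set of free variables of a context. -/
def fv : EvalCtx → Set ℕ
  | hole => ∅
  | appR v F => v.toTm.fv ∪ F.fv
  | appL F t => F.fv ∪ t.fv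
  | reset F => F.fv

end EvalCtx

open Tm

/-- One-step call-by-value reduction. -/
inductive Red : Tm → Tm → Prop
  | beta (F : EvalCtx) (b : Tm) (v : Value) :
      Red (F.fill (.app (.lam b) v.toTm)) (F.fill (b.inst v.toTm))
  | shift (F E : EvalCtx) (hE : E.IsPure) (b : Tm) (x : ℕ) (hx : x ∉ E.fv) :
      Red (F.fill (.reset (E.fill (.shift b))))
        (F.fill (.reset (b.inst (Lam x (.reset (E.fill (.var x)))))))
  | reset (F : EvalCtx) (v : Value) :
      Red (F.fill (.reset v.toTm)) (F.fill v.toTm)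

/-- Evaluation: `t` reduces in zero or more steps to `t'`, which does not reduce. -/
def Eval (t t' : Tm) : Prop :=
  Relation.ReflTransGen Red t t' ∧ ∀ u, ¬ Red t' u

/-- Extension of a relation on terms to evaluation contexts. -/
inductive CtxRel (R : Tm → Tm → Prop) : EvalCtx → EvalCtx → Prop
  | delim (F₀ F₁ E₀ E₁ : EvalCtx) (h₀ : E₀.IsPure) (h₁ : E₁.IsPure) (x : ℕ)
      (hx : x ∉ F₀.fv ∪ F₁.fv ∪ E₀.fv ∪ E₁.fv)
      (hF : R (F₀.fill (.var x)) (F₁.fill (.var x)))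
      (hE : R (.reset (E₀.fill (.var x))) (.reset (E₁.fill (.var x)))) :
      CtxRel R (F₀.comp (.reset E₀)) (F₁.comp (.reset E₁))
  | pure (E₀ E₁ : EvalCtx) (h₀ : E₀.IsPure) (h₁ : E₁.IsPure) (x : ℕ)
      (hx : x ∉ E₀.fv ∪ E₁.fv)
      (hE : R (E₀.fill (.var x)) (E₁.fill (.var x))) :
      CtxRel R E₀ E₁

/-- The relation on normal forms induced by a relation on terms. -/
inductive NF (R : Tm → Tm → Prop) : Tm → Tm → Prop
  | value (v₀ v₁ : Value) (x : ℕ) (hx : x ∉ v₀.toTm.fv ∪ v₁.toTm.fv)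
      (h : R (v₀.appVal x) (v₁.appVal x)) :
      NF R v₀.toTm v₁.toTm
  | control (E₀ E₁ : EvalCtx) (h₀ : E₀.IsPure) (h₁ : E₁.IsPure) (k : ℕ) (t₀ t₁ : Tm)
      (hE : CtxRel R E₀ E₁) (ht : R (.reset t₀) (.reset t₁)) :
      NF R (E₀.fill (Shift k t₀)) (E₁.fill (Shift k t₁))
  | openStuck (F₀ F₁ : EvalCtx) (x : ℕ) (v₀ v₁ : Value)
      (hF : CtxRel R F₀ F₁) (hv : NF R v₀.toTm v₁.toTm) :
      NF R (F₀.fill (.app (.var x) v₀.toTm)) (F₁.fill (.app (.var x) v₁.toTm))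

/-- The refined relation on normal forms induced by a relation on terms: it differs from `NF` on
control stuck terms only. -/
inductive RNF (R : Tm → Tm → Prop) : Tm → Tm → Prop
  | value (v₀ v₁ : Value) (x : ℕ) (hx : x ∉ v₀.toTm.fv ∪ v₁.toTm.fv)
      (h : R (v₀.appVal x) (v₁.appVal x)) :
      RNF R v₀.toTm v₁.toTm
  | control (E₀ E₁ : EvalCtx) (h₀ : E₀.IsPure) (h₁ : E₁.IsPure) (k : ℕ) (t₀ t₁ : Tm)
      (k' x : ℕ) (hk' : k' ∉ E₀.fv ∪ E₁.fv ∪ t₀.fv ∪ t₁.fv)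
      (hx : x ∉ E₀.fv ∪ E₁.fv ∪ t₀.fv ∪ t₁.fv) (hxk' : x ≠ k')
      (h : R (.reset (t₀.subst k (Lam x (.reset (.app (.var k') (E₀.fill (.var x)))))))
        (.reset (t₁.subst k (Lam x (.reset (.app (.var k') (E₁.fill (.var x)))))))) :
      RNF R (E₀.fill (Shift k t₀)) (E₁.fill (Shift k t₁))
  | openStuck (F₀ F₁ : EvalCtx) (x : ℕ) (v₀ v₁ : Value)
      (hF : CtxRel R F₀ F₁) (hv : RNF R v₀.toTm v₁.toTm) :
      RNF R (F₀.fill (.app (.var x) v₀.toTm)) (F₁.fill (.app (.var x) v₁.toTm))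

/-- Normal form simulations. -/
def IsSimulation (R : Tm → Tm → Prop) : Prop :=
  ∀ t₀ t₁ t₀', R t₀ t₁ → Eval t₀ t₀' → ∃ t₁', Eval t₁ t₁' ∧ NF R t₀' t₁'

/-- Normal form bisimulations: the relation and its inverse are simulations. -/
def IsBisimulation (R : Tm → Tm → Prop) : Prop :=
  IsSimulation R ∧ IsSimulation (flip R)

/-- Normal form bisimilarity: the union of all normal form bisimulations. -/
def Bisim (t₀ t₁ : Tm) : Prop :=
  ∃ R : Tm → Tm → Prop, IsBisimulation R ∧ R t₀ t₁

/-- Refined normal form simulations. -/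
def IsRefinedSimulation (R : Tm → Tm → Prop) : Prop :=
  ∀ t₀ t₁ t₀', R t₀ t₁ → Eval t₀ t₀' → ∃ t₁', Eval t₁ t₁' ∧ RNF R t₀' t₁'

/-- Refined normal form bisimulations: the relation and its inverse are refined simulations. -/
def IsRefinedBisimulation (R : Tm → Tm → Prop) : Prop :=
  IsRefinedSimulation R ∧ IsRefinedSimulation (flip R)

/-- Refined normal form bisimilarity: the union of all refined normal form bisimulations. -/
def RBisim (t₀ t₁ : Tm) : Prop :=
  ∃ R : Tm → Tm → Prop, IsRefinedBisimulation R ∧ R t₀ t₁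

end ShiftReset

/-! Both terms of the equivalence are control stuck, so the refined rule, used with a fresh variable
`j`, leaves a single pair to compare: `⟨t{λx.⟨j E[x]⟩/k}⟩` and `⟨t{λx.⟨(λy.⟨j y⟩) E[x]⟩/k}⟩`. They
differ only in that `j`, at the head of a reset, is replaced by `λy.⟨j y⟩`. `Rel j` is the
compatible closure of this replacement.

Related terms reduce in lockstep (`Rel.red`). A capture inside `⟨j E[·]⟩` puts the captured context
back under a reset, so the difference keeps its form. The sides part only when the argument becomes
a value: the left is stuck on `⟨j v⟩`, while the right takes one more step to `⟨⟨j v'⟩⟩`. The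
surplus reset is absorbed by relating terms up to reduction on the right (`RelRed`,
`Rel.rnf_of_normal`). The converse simulation follows from determinism and from transfer of
termination (`Rel.eval_converges`).

Plain bisimilarity compares the pure contexts themselves. For `(λz.Ω) □` against `□` this asks that
`(λz.Ω) x`, which diverges, be bisimilar to the value `x`. -/

namespace ShiftReset

/-! ### Renaming, substitution and free variables -/

namespace Tm

theorem upRen_comp (ξ ζ : ℕ → ℕ) : upRen ζ ∘ upRen ξ = upRen (ζ ∘ ξ) := by
  funext n; cases n <;> rfl

theorem up_comp_upRen (σ : ℕ → Tm) (ξ : ℕ → ℕ) : up σ ∘ upRen ξ = up (σ ∘ ξ) := by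
  funext n; cases n <;> rfl

theorem rename_rename (t : Tm) (ξ ζ : ℕ → ℕ) :
    (t.rename ξ).rename ζ = t.rename (ζ ∘ ξ) := by
  induction t generalizing ξ ζ with
  | var n => rfl
  | lam b ih => simp [rename, ih, upRen_comp]
  | app t u iht ihu => simp [rename, iht, ihu]
  | shift b ih => simp [rename, ih, upRen_comp]
  | reset t ih => simp [rename, ih]

theorem bind_rename (t : Tm) (ξ : ℕ → ℕ) (σ : ℕ → Tm) :
    (t.rename ξ).bind σ = t.bind (σ ∘ ξ) := by
  induction t generalizing ξ σ with
  | var n => rfl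
  | lam b ih => simp [rename, bind, ih, up_comp_upRen]
  | app t u iht ihu => simp [rename, bind, iht, ihu]
  | shift b ih => simp [rename, bind, ih, up_comp_upRen]
  | reset t ih => simp [rename, bind, ih]

theorem rename_up (σ : ℕ → Tm) (ξ : ℕ → ℕ) :
    (fun n => (up σ n).rename (upRen ξ)) = up (fun n => (σ n).rename ξ) := by
  funext n
  cases n with
  | zero => rfl
  | succ n => simp only [up, rename_rename]; rfl

theorem rename_bind (t : Tm) (σ : ℕ → Tm) (ξ : ℕ → ℕ) :
    (t.bind σ).rename ξ = t.bind (fun n => (σ n).rename ξ) := by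
  induction t generalizing ξ σ with
  | var n => rfl
  | lam b ih => simp [rename, bind, ih, rename_up]
  | app t u iht ihu => simp [rename, bind, iht, ihu]
  | shift b ih => simp [rename, bind, ih, rename_up]
  | reset t ih => simp [rename, bind, ih]

theorem bind_up (σ τ : ℕ → Tm) :
    (fun n => (up σ n).bind (up τ)) = up (fun n => (σ n).bind τ) := by
  funext n
  cases n with
  | zero => rfl
  | succ n => simp only [up, bind_rename, rename_bind]; rfl

theorem bind_bind (t : Tm) (σ τ : ℕ → Tm) :
    (t.bind σ).bind τ = t.bind (fun n => (σ n).bind τ) := by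
  induction t generalizing σ τ with
  | var n => rfl
  | lam b ih => simp [bind, ih, bind_up]
  | app t u iht ihu => simp [bind, iht, ihu]
  | shift b ih => simp [bind, ih, bind_up]
  | reset t ih => simp [bind, ih]

theorem bind_congr {t : Tm} {σ τ : ℕ → Tm} (h : ∀ n ∈ t.fv, σ n = τ n) :
    t.bind σ = t.bind τ := by
  have hup : ∀ {b : Tm} {σ τ : ℕ → Tm}, (∀ n, n + 1 ∈ b.fv → σ n = τ n) →
      ∀ n ∈ b.fv, up σ n = up τ n := by
    intro b σ τ h n hn
    cases n with
    | zero => rfl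
    | succ n => simp only [up, h n hn]
  induction t generalizing σ τ with
  | var n => exact h n rfl
  | lam b ih => simp only [bind]; rw [ih (hup h)]
  | app t u iht ihu =>
    simp only [bind]
    rw [iht fun n hn => h n (Or.inl hn), ihu fun n hn => h n (Or.inr hn)]
  | shift b ih => simp only [bind]; rw [ih (hup h)]
  | reset t ih => simp only [bind]; rw [ih h]

theorem up_var (ξ : ℕ → ℕ) : up (fun n => var (ξ n)) = fun n => var (upRen ξ n) := by
  funext n; cases n <;> rfl

theorem rename_eq_bind (t : Tm) (ξ : ℕ → ℕ) : t.rename ξ = t.bind fun n => var (ξ n) := by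
  induction t generalizing ξ with
  | var n => rfl
  | lam b ih => simp [rename, bind, ih, up_var]
  | app t u iht ihu => simp [rename, bind, iht, ihu]
  | shift b ih => simp [rename, bind, ih, up_var]
  | reset t ih => simp [rename, bind, ih]

theorem rename_congr {t : Tm} {ξ ζ : ℕ → ℕ} (h : ∀ n ∈ t.fv, ξ n = ζ n) :
    t.rename ξ = t.rename ζ := by
  rw [rename_eq_bind, rename_eq_bind]
  exact bind_congr fun n hn => by rw [h n hn]

theorem bind_var (t : Tm) : t.bind var = t := by
  have hup : up var = var := by funext n; cases n <;> rfl
  induction t with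
  | var n => rfl
  | lam b ih => simp [bind, ih, hup]
  | app t u iht ihu => simp [bind, iht, ihu]
  | shift b ih => simp [bind, ih, hup]
  | reset t ih => simp [bind, ih]

theorem abstr_inst (x : ℕ) (t u : Tm) : (abstr x t).inst u = t.subst x u := by
  rw [abstr, inst, bind_rename, subst]
  congr 1
  funext n
  by_cases h : n = x <;> simp [h]

/-- Any de Bruijn body can be presented as a named one with a fresh name. Inside the body, the free
variable `x` has index `x + 1`. -/
theorem abstr_inst_var {b : Tm} {x : ℕ} (hx : x + 1 ∉ b.fv) :
    abstr x (b.inst (var x)) = b := by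
  rw [abstr, inst, rename_bind]
  conv_rhs => rw [← bind_var b]
  refine bind_congr fun n hn => ?_
  cases n with
  | zero => simp [rename]
  | succ n =>
    have : n ≠ x := by rintro rfl; exact hx hn
    simp [rename, this]

theorem fv_finite (t : Tm) : t.fv.Finite := by
  induction t with
  | var n => exact Set.finite_singleton n
  | lam b ih => exact ih.preimage (f := Nat.succ) (Nat.succ_injective.injOn)
  | app t u iht ihu => exact iht.union ihu
  | shift b ih => exact ih.preimage (f := Nat.succ) (Nat.succ_injective.injOn)
  | reset t ih => exact ih

theorem fv_inst_var {b : Tm} {x n : ℕ} (h : n ∈ (b.inst (var x)).fv) :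
    n + 1 ∈ b.fv ∨ n = x := by
  have key : ∀ (b : Tm) (σ : ℕ → Tm) (n : ℕ), n ∈ (b.bind σ).fv → ∃ m ∈ b.fv, n ∈ (σ m).fv := by
    have hren : ∀ (t : Tm) (ξ : ℕ → ℕ) (n : ℕ), n ∈ (t.rename ξ).fv → ∃ m ∈ t.fv, ξ m = n := by
      intro t
      induction t with
      | var m => intro ξ n hn; exact ⟨m, rfl, hn.symm⟩
      | app t u iht ihu =>
        rintro ξ n (hn | hn)
        · obtain ⟨m, hm, e⟩ := iht ξ n hn; exact ⟨m, Or.inl hm, e⟩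
        · obtain ⟨m, hm, e⟩ := ihu ξ n hn; exact ⟨m, Or.inr hm, e⟩
      | reset t ih => exact ih
      | lam b ih | shift b ih =>
        intro ξ n hn
        obtain ⟨m, hm, e⟩ := ih _ _ hn
        cases m with
        | zero => simp [upRen] at e
        | succ m => exact ⟨m, hm, by simpa [upRen] using e⟩
    intro b
    induction b with
    | var m => intro σ n hn; exact ⟨m, rfl, hn⟩
    | app t u iht ihu =>
      rintro σ n (hn | hn)
      · obtain ⟨m, hm, e⟩ := iht σ n hn; exact ⟨m, Or.inl hm, e⟩
      · obtain ⟨m, hm, e⟩ := ihu σ n hn; exact ⟨m, Or.inr hm, e⟩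
    | reset t ih => exact ih
    | lam b ih | shift b ih =>
      intro σ n hn
      obtain ⟨m, hm, e⟩ := ih _ _ hn
      cases m with
      | zero => simp [up, fv] at e
      | succ m =>
        obtain ⟨j, hj, e'⟩ := hren _ _ _ e
        exact ⟨m, hm, by rwa [← Nat.succ_injective e']⟩
  obtain ⟨m, hm, e⟩ := key _ _ _ h
  cases m with
  | zero => exact Or.inr e
  | succ m =>
    have e' : n = m := e
    exact Or.inl (e' ▸ hm)

end Tm

open Tm

/-! ### Renaming and free variables of values and contexts -/

theorem Value.toTm_injective : Function.Injective Value.toTm := by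
  rintro (a | a) (b | b) h <;> simp_all [Value.toTm]

/-- Renaming of the free variables of a value. -/
def Value.rename (ξ : ℕ → ℕ) : Value → Value
  | .var n => .var (ξ n)
  | .lam b => .lam (b.rename (upRen ξ))

theorem Value.toTm_rename (ξ : ℕ → ℕ) (v : Value) : (v.rename ξ).toTm = v.toTm.rename ξ := by
  cases v <;> rfl

namespace EvalCtx

/-- Renaming of the free variables of a context. -/
def rename (ξ : ℕ → ℕ) : EvalCtx → EvalCtx
  | hole => hole
  | appR v F => appR (v.rename ξ) (F.rename ξ)
  | appL F t => appL (F.rename ξ) (t.rename ξ)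
  | reset F => reset (F.rename ξ)

theorem rename_fill (ξ : ℕ → ℕ) (F : EvalCtx) (t : Tm) :
    (F.fill t).rename ξ = (F.rename ξ).fill (t.rename ξ) := by
  induction F <;> simp_all [fill, Tm.rename, rename, Value.toTm_rename]

theorem rename_congr {F : EvalCtx} {ξ ζ : ℕ → ℕ} (h : ∀ n ∈ F.fv, ξ n = ζ n) :
    F.rename ξ = F.rename ζ := by
  induction F with
  | hole => rfl
  | appR v F ih =>
    have hv : v.rename ξ = v.rename ζ := Value.toTm_injective (by
      rw [Value.toTm_rename, Value.toTm_rename]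
      exact Tm.rename_congr fun n hn => h n (Or.inl hn))
    simp only [rename]
    rw [ih fun n hn => h n (Or.inr hn), hv]
  | appL F t ih =>
    simp only [rename]
    rw [ih fun n hn => h n (Or.inl hn), Tm.rename_congr fun n hn => h n (Or.inr hn)]
  | reset F ih => simp only [rename]; rw [ih h]

theorem fv_fill (F : EvalCtx) (t : Tm) : (F.fill t).fv = F.fv ∪ t.fv := by
  induction F with
  | hole => simp [fill, fv]
  | appR v F ih => simp [fill, fv, Tm.fv, ih, Set.union_assoc]
  | appL F u ih => simp only [fill, fv, Tm.fv, ih, Set.union_right_comm]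
  | reset F ih => simpa [fill, fv, Tm.fv] using ih

theorem fv_finite (F : EvalCtx) : F.fv.Finite :=
  (F.fill (.var 0)).fv_finite.subset (by rw [fv_fill]; exact Set.subset_union_left)

theorem fill_comp (F G : EvalCtx) (t : Tm) : (F.comp G).fill t = F.fill (G.fill t) := by
  induction F <;> simp_all [fill, comp]

theorem not_isPure_comp_reset (F E : EvalCtx) : ¬ (F.comp (reset E)).IsPure := by
  induction F <;> simp_all [comp, IsPure]

/-- The body of the continuation `λx.⟨E[x]⟩`. -/
def body (E : EvalCtx) : Tm := .reset ((E.rename Nat.succ).fill (.var 0))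

theorem abstr_fill {E : EvalCtx} {x : ℕ} (hx : x ∉ E.fv) :
    abstr x (E.fill (.var x)) = (E.rename Nat.succ).fill (.var 0) := by
  rw [abstr, rename_fill, rename_congr (ζ := Nat.succ)]
  · simp [Tm.rename]
  · intro n hn
    have : n ≠ x := by rintro rfl; exact hx hn
    simp [this]

/-- The captured continuation does not depend on the fresh name, so the shift rule is deterministic.
-/
theorem Lam_reset_fill {E : EvalCtx} {x : ℕ} (hx : x ∉ E.fv) :
    Lam x (.reset (E.fill (.var x))) = .lam E.body := by
  rw [body, ← abstr_fill hx]; rfl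

end EvalCtx

/-! ### Decomposition of terms -/

/-- The possible outcomes of decomposing a term: a value, an open stuck term, a control stuck term,
or a term that reduces. -/
inductive View : Type
  | val (v : Value) : View
  | stuck (F : EvalCtx) (x : ℕ) (v : Value) : View
  | control (E : EvalCtx) (b : Tm) : View
  | step (t : Tm) : View

namespace View

/-- The view of `⟨t⟩` from that of `t`. -/
def reset : View → View
  | val v => step v.toTm
  | stuck F x v => stuck (.reset F) x v
  | control E b => step (.reset (b.inst (.lam E.body)))
  | step t => step (.reset t)

/-- The view of `v w` for values `v` and `w`. -/
def appVal : Value → Value → View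
  | .var x, w => stuck .hole x w
  | .lam b, w => step (b.inst w.toTm)

/-- The view of `v u` from that of `u`. -/
def appR (v : Value) : View → View
  | val w => appVal v w
  | stuck F x w => stuck (.appR v F) x w
  | control E b => control (.appR v E) b
  | step u => step (.app v.toTm u)

/-- The view of `t u` from those of `t` and `u`. -/
def app (u : Tm) (b : View) : View → View
  | val v => appR v b
  | stuck F x v => stuck (.appL F u) x v
  | control E c => control (.appL E u) c
  | step t => step (.app t u)

/-- The view of a term. -/
def of : Tm → View
  | .var n => val (.var n)
  | .lam b => val (.lam b)
  | .app t u => app u (of u) (of t)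
  | .shift b => control .hole b
  | .reset t => reset (of t)

/-- The term `t` has the given view. -/
def Spec (t : Tm) : View → Prop
  | val v => t = v.toTm
  | stuck F x v => t = F.fill (.app (.var x) v.toTm)
  | control E b => E.IsPure ∧ t = E.fill (.shift b)
  | step t' => Red t t'

end View

theorem Red.fill {t t' : Tm} (h : Red t t') (F : EvalCtx) : Red (F.fill t) (F.fill t') := by
  cases h with
  | beta G b v =>
    rw [← EvalCtx.fill_comp, ← EvalCtx.fill_comp]; exact .beta _ b v
  | shift G E hE b x hx =>
    rw [← EvalCtx.fill_comp, ← EvalCtx.fill_comp]; exact .shift _ E hE b x hx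
  | reset G v =>
    rw [← EvalCtx.fill_comp, ← EvalCtx.fill_comp]; exact .reset _ v

namespace View

theorem spec_of (t : Tm) : Spec t (of t) := by
  induction t with
  | var n => rfl
  | lam b => rfl
  | shift b => exact ⟨trivial, rfl⟩
  | reset t ih =>
    simp only [of]
    generalize of t = a at ih
    cases a with
    | val v => subst ih; exact Red.reset .hole v
    | stuck F x v => subst ih; rfl
    | step t' => exact Red.fill ih (.reset .hole)
    | control E b =>
      obtain ⟨hE, rfl⟩ := ih
      obtain ⟨x, hx⟩ := E.fv_finite.exists_notMem
      have := Red.shift .hole E hE b x hx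
      rwa [EvalCtx.Lam_reset_fill hx] at this
  | app t u iht ihu =>
    simp only [of]
    generalize of t = a at iht
    generalize of u = c at ihu
    cases a with
    | stuck F x v => subst iht; rfl
    | control E b => obtain ⟨hE, rfl⟩ := iht; exact ⟨hE, rfl⟩
    | step t' => exact Red.fill iht (.appL .hole u)
    | val v =>
      cases c with
      | stuck F x w => subst iht ihu; rfl
      | control E b => obtain ⟨hE, rfl⟩ := ihu; subst iht; exact ⟨hE, rfl⟩
      | step u' => subst iht; exact Red.fill ihu (.appR v .hole)
      | val w =>
        subst iht ihu
        cases v with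
        | var x => rfl
        | lam b => exact Red.beta .hole b w

theorem of_toTm (v : Value) : of v.toTm = val v := by cases v <;> rfl

theorem of_fill_step {t t' : Tm} (h : of t = step t') (F : EvalCtx) :
    of (F.fill t) = step (F.fill t') := by
  induction F <;> simp_all [EvalCtx.fill, of, app, appR, reset, of_toTm]

theorem of_fill_shift {E : EvalCtx} (hE : E.IsPure) (b : Tm) :
    of (E.fill (.shift b)) = control E b := by
  induction E <;> simp_all [EvalCtx.fill, of, app, appR, of_toTm, EvalCtx.IsPure]

theorem of_fill_stuck (F : EvalCtx) (x : ℕ) (v : Value) :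
    of (F.fill (.app (.var x) v.toTm)) = stuck F x v := by
  induction F <;> simp_all [EvalCtx.fill, of, app, appR, appVal, reset, of_toTm]

/-- Unique decomposition: since `View.of` is a function, determinism and the normality of values and
stuck terms become computations. -/
theorem red_iff {t t' : Tm} : Red t t' ↔ of t = step t' := by
  refine ⟨fun h => ?_, fun h => by simpa only [h, Spec] using spec_of t⟩
  cases h with
  | beta F b v => exact of_fill_step (by simp [of, app, appR, appVal, of_toTm]) F
  | reset F v => exact of_fill_step (by simp [of, reset, of_toTm]) F
  | shift F E hE b x hx =>
    refine of_fill_step ?_ F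
    rw [EvalCtx.Lam_reset_fill hx, of, of_fill_shift hE, reset]

end View

/-! ### Determinism and evaluation -/

theorem Red.deterministic {t u u' : Tm} (h : Red t u) (h' : Red t u') : u = u' := by
  rw [View.red_iff] at h h'
  simpa using h.symm.trans h'

theorem Eval.head {t u w : Tm} (h : Red t u) (h' : Eval u w) : Eval t w :=
  ⟨h'.1.head h, h'.2⟩

theorem Eval.of_normal {t : Tm} (h : ∀ u, ¬ Red t u) : Eval t t := ⟨.refl, h⟩

theorem Eval.of_red {t u w : Tm} (h : Red t u) (h' : Eval t w) : Eval u w := by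
  rcases h'.1.cases_head with rfl | ⟨u', hu, hw⟩
  · exact absurd h (h'.2 _)
  · rw [h.deterministic hu]; exact ⟨hw, h'.2⟩

theorem Eval.of_reds {t u w : Tm} (h : Relation.ReflTransGen Red t u) (h' : Eval t w) :
    Eval u w := by
  induction h with
  | refl => exact h'
  | tail _ hr ih => exact ih.of_red hr

theorem Eval.eq_of_normal {t w : Tm} (ht : ∀ u, ¬ Red t u) (h : Eval t w) : w = t := by
  rcases h.1.cases_head with rfl | ⟨u, hu, -⟩
  · rfl
  · exact absurd hu (ht u)

theorem Eval.deterministic {t u w : Tm} (h : Eval t u) (h' : Eval t w) : w = u :=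
  Eval.eq_of_normal h.2 (Eval.of_reds h.1 h')

theorem normal_fill_shift {E : EvalCtx} (hE : E.IsPure) (b u : Tm) :
    ¬ Red (E.fill (.shift b)) u := by
  rw [View.red_iff, View.of_fill_shift hE]; simp

theorem normal_fill_stuck (F : EvalCtx) (x : ℕ) (v : Value) (u : Tm) :
    ¬ Red (F.fill (.app (.var x) v.toTm)) u := by
  rw [View.red_iff, View.of_fill_stuck]; simp

theorem normal_value (v : Value) (u : Tm) : ¬ Red v.toTm u := by
  rw [View.red_iff, View.of_toTm]; simp

/-! ### Expanding the continuation variable -/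

/-- The expansion `λy.⟨k y⟩` of the variable `k`. -/
def expansion (k : ℕ) : Tm := .lam (.reset (.app (.var (k + 1)) (.var 0)))

/-- The compatible relation that allows `⟨k t⟩` on the left to be `⟨(λy.⟨k y⟩) t⟩` on the right. -/
inductive Rel : ℕ → Tm → Tm → Prop
  | var (k n : ℕ) : Rel k (.var n) (.var n)
  | lam {k : ℕ} {b b' : Tm} (h : Rel (k + 1) b b') : Rel k (.lam b) (.lam b')
  | app {k : ℕ} {t t' u u' : Tm} (ht : Rel k t t') (hu : Rel k u u') :
      Rel k (.app t u) (.app t' u')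
  | shift {k : ℕ} {b b' : Tm} (h : Rel (k + 1) b b') : Rel k (.shift b) (.shift b')
  | reset {k : ℕ} {t t' : Tm} (h : Rel k t t') : Rel k (.reset t) (.reset t')
  | expand {k : ℕ} {t t' : Tm} (h : Rel k t t') :
      Rel k (.reset (.app (.var k) t)) (.reset (.app (expansion k) t'))

namespace Rel

theorem rename {k : ℕ} {t t' : Tm} (h : Rel k t t') (ξ : ℕ → ℕ) :
    Rel (ξ k) (t.rename ξ) (t'.rename ξ) := by
  induction h generalizing ξ with
  | var k n => exact .var _ _
  | lam _ ih => exact .lam (ih (upRen ξ))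
  | app _ _ iht ihu => exact .app (iht ξ) (ihu ξ)
  | shift _ ih => exact .shift (ih (upRen ξ))
  | reset _ ih => exact .reset (ih ξ)
  | expand _ ih => exact .expand (ih ξ)

theorem up {k : ℕ} {σ σ' : ℕ → Tm} (hσ : ∀ n, Rel k (σ n) (σ' n)) (n : ℕ) :
    Rel (k + 1) (Tm.up σ n) (Tm.up σ' n) := by
  cases n with
  | zero => exact .var _ _
  | succ n => exact (hσ n).rename Nat.succ

/-- The distinguished variable must go to a variable, because `expand` has it at the head of an
application. -/
theorem bind {k k' : ℕ} {t t' : Tm} (h : Rel k t t') {σ σ' : ℕ → Tm}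
    (hσ : ∀ n, Rel k' (σ n) (σ' n)) (hk : σ k = .var k') (hk' : σ' k = .var k') :
    Rel k' (t.bind σ) (t'.bind σ') := by
  induction h generalizing k' σ σ' with
  | var k n => exact hσ n
  | lam _ ih => exact .lam (ih (up hσ) (by simp [Tm.up, hk, Tm.rename])
      (by simp [Tm.up, hk', Tm.rename]))
  | app _ _ iht ihu => exact .app (iht hσ hk hk') (ihu hσ hk hk')
  | shift _ ih => exact .shift (ih (up hσ) (by simp [Tm.up, hk, Tm.rename])
      (by simp [Tm.up, hk', Tm.rename]))
  | reset _ ih => exact .reset (ih hσ hk hk')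
  | expand _ ih =>
    simpa [Tm.bind, expansion, Tm.up, hk, hk', Tm.rename] using expand (ih hσ hk hk')

/-- With the same term on both sides `expand` is never met in `t`, so `k` itself may be substituted
freely. -/
theorem bind_self {k : ℕ} (t : Tm) {σ σ' : ℕ → Tm} (hσ : ∀ n, Rel k (σ n) (σ' n)) :
    Rel k (t.bind σ) (t.bind σ') := by
  induction t generalizing k σ σ' with
  | var n => exact hσ n
  | lam b ih => exact .lam (ih (up hσ))
  | app t u iht ihu => exact .app (iht hσ) (ihu hσ)
  | shift b ih => exact .shift (ih (up hσ))
  | reset t ih => exact .reset (ih hσ)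

theorem refl (k : ℕ) (t : Tm) : Rel k t t := by
  simpa only [bind_var] using bind_self t fun n => .var k n

theorem inst {k : ℕ} {b b' u u' : Tm} (h : Rel (k + 1) b b') (hu : Rel k u u') :
    Rel k (b.inst u) (b'.inst u') :=
  h.bind (fun n => by cases n with
    | zero => exact hu
    | succ n => exact .var _ _) rfl rfl

end Rel

/-- The extension of `Rel` to evaluation contexts. -/
inductive RelCtx : ℕ → EvalCtx → EvalCtx → Prop
  | hole (k : ℕ) : RelCtx k .hole .hole
  | appR {k : ℕ} {v v' : Value} {F F' : EvalCtx} (hv : Rel k v.toTm v'.toTm)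
      (hF : RelCtx k F F') : RelCtx k (.appR v F) (.appR v' F')
  | appL {k : ℕ} {F F' : EvalCtx} {t t' : Tm} (hF : RelCtx k F F') (ht : Rel k t t') :
      RelCtx k (.appL F t) (.appL F' t')
  | reset {k : ℕ} {F F' : EvalCtx} (hF : RelCtx k F F') : RelCtx k (.reset F) (.reset F')
  | expand {k : ℕ} {F F' : EvalCtx} (hF : RelCtx k F F') :
      RelCtx k (.reset (.appR (.var k) F))
        (.reset (.appR (.lam (.reset (.app (.var (k + 1)) (.var 0)))) F'))

namespace RelCtx

theorem fill {k : ℕ} {F F' : EvalCtx} (h : RelCtx k F F') {t t' : Tm} (ht : Rel k t t') :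
    Rel k (F.fill t) (F'.fill t') := by
  induction h with
  | hole => exact ht
  | appR hv _ ih => exact .app hv ih
  | appL _ hu ih => exact .app ih hu
  | reset _ ih => exact .reset ih
  | expand _ ih => exact .expand ih

theorem rename {k : ℕ} {F F' : EvalCtx} (h : RelCtx k F F') (ξ : ℕ → ℕ) :
    RelCtx (ξ k) (F.rename ξ) (F'.rename ξ) := by
  induction h with
  | hole => exact .hole _
  | appR hv _ ih =>
    exact .appR (by rw [Value.toTm_rename, Value.toTm_rename]; exact hv.rename ξ) ih
  | appL _ hu ih => exact .appL ih (hu.rename ξ)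
  | reset _ ih => exact .reset ih
  | expand _ ih => exact .expand ih

theorem body {k : ℕ} {E E' : EvalCtx} (h : RelCtx k E E') : Rel (k + 1) E.body E'.body :=
  .reset ((h.rename Nat.succ).fill (.var _ _))

/-- Splitting at the innermost reset matches the two rules of `CtxRel`. The inner parts are related
only under their reset, since `k F` and `(λy.⟨k y⟩) F'` need not be related without it. -/
theorem pure_or_delim {k : ℕ} {F F' : EvalCtx} (h : RelCtx k F F') :
    (F.IsPure ∧ F'.IsPure) ∨
    ∃ G G' E E' : EvalCtx, F = G.comp (.reset E) ∧ F' = G'.comp (.reset E') ∧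
      E.IsPure ∧ E'.IsPure ∧ RelCtx k G G' ∧ RelCtx k (.reset E) (.reset E') := by
  induction h with
  | hole => exact .inl ⟨trivial, trivial⟩
  | appR hv _ ih =>
    rcases ih with h | ⟨G, G', E, E', rfl, rfl, hE, hE', hG, hR⟩
    · exact .inl h
    · exact .inr ⟨.appR _ G, .appR _ G', E, E', rfl, rfl, hE, hE', .appR hv hG, hR⟩
  | appL _ hu ih =>
    rcases ih with h | ⟨G, G', E, E', rfl, rfl, hE, hE', hG, hR⟩
    · exact .inl h
    · exact .inr ⟨.appL G _, .appL G' _, E, E', rfl, rfl, hE, hE', .appL hG hu, hR⟩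
  | reset hF ih =>
    rcases ih with h | ⟨G, G', E, E', rfl, rfl, hE, hE', hG, hR⟩
    · exact .inr ⟨.hole, .hole, _, _, rfl, rfl, h.1, h.2, .hole _, .reset hF⟩
    · exact .inr ⟨.reset G, .reset G', E, E', rfl, rfl, hE, hE', .reset hG, hR⟩
  | expand hF ih =>
    rcases ih with h | ⟨G, G', E, E', rfl, rfl, hE, hE', hG, hR⟩
    · exact .inr ⟨.hole, .hole, _, _, rfl, rfl, h.1, h.2, .hole _, .expand hF⟩
    · exact .inr ⟨.reset (.appR _ G), .reset (.appR _ G'), E, E', rfl, rfl, hE, hE',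
        .expand hG, hR⟩

end RelCtx

/-- How the views of terms related by `Rel` correspond. -/
inductive RelView (k : ℕ) : View → View → Prop
  | val {v v' : Value} (h : Rel k v.toTm v'.toTm) : RelView k (.val v) (.val v')
  | stuck {F F' : EvalCtx} (x : ℕ) {v v' : Value} (hF : RelCtx k F F')
      (h : Rel k v.toTm v'.toTm) : RelView k (.stuck F x v) (.stuck F' x v')
  | control {E E' : EvalCtx} {b b' : Tm} (hE : RelCtx k E E') (h : Rel (k + 1) b b') :
      RelView k (.control E b) (.control E' b')
  | step {t t' : Tm} (h : Rel k t t') : RelView k (.step t) (.step t')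
  | expand {G G' : EvalCtx} {v v' : Value} (hG : RelCtx k G G') (h : Rel k v.toTm v'.toTm) :
      RelView k (.stuck (G.comp (.reset .hole)) k v)
        (.step (G'.fill (.reset (.reset (.app (.var k) v'.toTm)))))

theorem Rel.view {k : ℕ} {t t' : Tm} (h : Rel k t t') : RelView k (View.of t) (View.of t') := by
  induction h with
  | var k n => exact .val (v := .var n) (v' := .var n) (.var k n)
  | lam h _ => exact .val (v := .lam _) (v' := .lam _) (.lam h)
  | shift h _ => exact .control (.hole _) h
  | @reset k t t' h ih =>
    simp only [View.of]
    generalize View.of t = a at ih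
    generalize View.of t' = a' at ih
    cases ih with
    | val h => exact .step h
    | stuck x hF h => exact .stuck x (.reset hF) h
    | control hE h => exact .step (.reset (h.inst (.lam hE.body)))
    | step h => exact .step (.reset h)
    | expand hG h => exact .expand (.reset hG) h
  | @expand k t t' h ih =>
    simp only [View.of, expansion, View.app]
    generalize View.of t = a at ih
    generalize View.of t' = a' at ih
    cases ih with
    | @val v v' h =>
      -- The argument is a value: the left is stuck on `k`, the right fires its beta-redex.
      have := RelView.expand (.hole k) h
      cases v' <;> exact this
    | stuck x hF h => exact .stuck x (.expand hF) h
    | control hE h =>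
      -- The captured contexts sit under the reset of the continuations, so `expand` relates the two
      -- bodies again.
      exact .step (.reset (h.inst (.lam (.expand ((hE.rename Nat.succ).fill (.var _ _))))))
    | step h => exact .step (.expand h)
    | expand hG h => exact .expand (.expand hG) h
  | @app k t t' u u' ht hu iht ihu =>
    simp only [View.of]
    generalize View.of t = a at iht
    generalize View.of t' = a' at iht
    generalize View.of u = c at ihu
    generalize View.of u' = c' at ihu
    cases iht with
    | stuck x hF h => exact .stuck x (.appL hF hu) h
    | control hE h => exact .control (.appL hE hu) h
    | step h => exact .step (.app h hu)
    | expand hG h => exact .expand (.appL hG hu) h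
    | @val v v' hv =>
      cases ihu with
      | stuck x hF h => exact .stuck x (.appR hv hF) h
      | control hE h => exact .control (.appR hv hE) h
      | step h => exact .step (.app hv h)
      | expand hG h => exact .expand (.appR hv hG) h
      | val hw =>
        cases v <;> cases v' <;> cases hv
        · exact .stuck _ (.hole k) hw
        · rename_i hb; exact .step (hb.inst hw)

/-! ### The refined bisimulation -/

theorem CtxRel.mono {R S : Tm → Tm → Prop} (hRS : ∀ t u, R t u → S t u) {F F' : EvalCtx}
    (h : CtxRel R F F') : CtxRel S F F' := by
  cases h with
  | delim F₀ F₁ E₀ E₁ h₀ h₁ x hx hF hE =>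
    exact .delim F₀ F₁ E₀ E₁ h₀ h₁ x hx (hRS _ _ hF) (hRS _ _ hE)
  | pure _ _ h₀ h₁ x hx hE => exact .pure _ _ h₀ h₁ x hx (hRS _ _ hE)

theorem RNF.mono {R S : Tm → Tm → Prop} (hRS : ∀ t u, R t u → S t u) {t u : Tm}
    (h : RNF R t u) : RNF S t u := by
  induction h with
  | value v₀ v₁ x hx h => exact .value v₀ v₁ x hx (hRS _ _ h)
  | control E₀ E₁ h₀ h₁ k t₀ t₁ k' x hk' hx hxk' h =>
    exact .control E₀ E₁ h₀ h₁ k t₀ t₁ k' x hk' hx hxk' (hRS _ _ h)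
  | openStuck F₀ F₁ x v₀ v₁ hF _ ih => exact .openStuck F₀ F₁ x v₀ v₁ (hF.mono hRS) ih

theorem CtxRel.flip {R : Tm → Tm → Prop} {F F' : EvalCtx} (h : CtxRel R F F') :
    CtxRel (flip R) F' F := by
  cases h with
  | delim F₀ F₁ E₀ E₁ h₀ h₁ x hx hF hE =>
    exact .delim F₁ F₀ E₁ E₀ h₁ h₀ x (by simp only [Set.mem_union] at hx ⊢; tauto) hF hE
  | pure _ _ h₀ h₁ x hx hE => exact .pure _ _ h₁ h₀ x (by rwa [Set.union_comm]) hE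

theorem RNF.flip {R : Tm → Tm → Prop} {t u : Tm} (h : RNF R t u) : RNF (flip R) u t := by
  induction h with
  | value v₀ v₁ x hx h => exact .value v₁ v₀ x (by rwa [Set.union_comm]) h
  | control E₀ E₁ h₀ h₁ k t₀ t₁ k' x hk' hx hxk' h =>
    exact .control E₁ E₀ h₁ h₀ k t₁ t₀ k' x (by simp only [Set.mem_union] at hk' ⊢; tauto)
      (by simp only [Set.mem_union] at hx ⊢; tauto) hxk' h
  | openStuck F₀ F₁ x v₀ v₁ hF _ ih => exact .openStuck F₁ F₀ x v₁ v₀ hF.flip ih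

/-- The rule for control stuck terms, with the bodies of the control operators given by their
de Bruijn representation. -/
theorem RNF.control_inst {R : Tm → Tm → Prop} {E₀ E₁ : EvalCtx} (h₀ : E₀.IsPure) (h₁ : E₁.IsPure)
    {b₀ b₁ : Tm} {k' : ℕ} (hk' : k' ∉ (E₀.fill (.shift b₀)).fv ∪ (E₁.fill (.shift b₁)).fv)
    (h : R (.reset (b₀.inst (.lam (EvalCtx.appR (.var k') E₀).body)))
      (.reset (b₁.inst (.lam (EvalCtx.appR (.var k') E₁).body)))) :
    RNF R (E₀.fill (.shift b₀)) (E₁.fill (.shift b₁)) := by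
  obtain ⟨k, hk⟩ := (((E₀.fill (.shift b₀)).fv_finite.union
    (E₁.fill (.shift b₁)).fv_finite).union (Set.finite_singleton k')).exists_notMem
  -- `x` must avoid `k` as well, since `k` may occur free in the named bodies `b.inst (.var k)`.
  obtain ⟨x, hx⟩ := ((((E₀.fill (.shift b₀)).fv_finite.union
    (E₁.fill (.shift b₁)).fv_finite).union (Set.finite_singleton k')).union
    (Set.finite_singleton k)).exists_notMem
  simp only [EvalCtx.fv_fill, Set.mem_union, not_or, Set.mem_singleton_iff] at hk' hk hx
  have e₀ : Shift k (b₀.inst (.var k)) = .shift b₀ :=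
    congrArg Tm.shift (abstr_inst_var (x := k) hk.1.1.2)
  have e₁ : Shift k (b₁.inst (.var k)) = .shift b₁ :=
    congrArg Tm.shift (abstr_inst_var (x := k) hk.1.2.2)
  have mem : ∀ {b : Tm} {n : ℕ}, n ∉ (Tm.shift b).fv → n ≠ k → n ∉ (b.inst (.var k)).fv :=
    fun h₁ h₂ h => (fv_inst_var h).elim h₁ h₂
  have hsub : ∀ {E : EvalCtx} {b : Tm}, x ∉ E.fv → k ∉ (Tm.shift b).fv →
      (b.inst (.var k)).subst k (Lam x (.reset (.app (.var k') (E.fill (.var x))))) =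
        b.inst (.lam (EvalCtx.appR (.var k') E).body) := by
    intro E b hxE hkb
    have hx' : x ∉ (EvalCtx.appR (.var k') E).fv := by
      rintro (h | h)
      · exact hx.1.2 h
      · exact hxE h
    have := EvalCtx.Lam_reset_fill hx'
    simp only [EvalCtx.fill, Value.toTm] at this
    rw [this, ← abstr_inst, abstr_inst_var (x := k) hkb]
  rw [← e₀, ← e₁]
  refine .control E₀ E₁ h₀ h₁ k _ _ k' x ?_ ?_ hx.1.2 ?_
  · simp only [Set.mem_union, not_or]
    exact ⟨⟨⟨hk'.1.1, hk'.2.1⟩, mem hk'.1.2 (Ne.symm hk.2)⟩, mem hk'.2.2 (Ne.symm hk.2)⟩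
  · simp only [Set.mem_union, not_or]
    exact ⟨⟨⟨hx.1.1.1.1, hx.1.1.2.1⟩, mem hx.1.1.1.2 hx.2⟩, mem hx.1.1.2.2 hx.2⟩
  · rwa [hsub hx.1.1.1.1 hk.1.1.2, hsub hx.1.1.2.1 hk.1.2.2]

/-- The relation `Rel` up to reduction on the right. -/
def RelRed (k : ℕ) (t t' : Tm) : Prop :=
  ∃ u, Relation.ReflTransGen Red t' u ∧ Rel k t u

theorem Rel.relRed {k : ℕ} {t t' : Tm} (h : Rel k t t') : RelRed k t t' := ⟨t', .refl, h⟩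

theorem RelCtx.ctxRel {k : ℕ} {F F' : EvalCtx} (h : RelCtx k F F') :
    CtxRel (RelRed k) F F' := by
  rcases h.pure_or_delim with ⟨hF, hF'⟩ | ⟨G, G', E, E', rfl, rfl, hE, hE', hG, hR⟩
  · obtain ⟨x, hx⟩ := (F.fv_finite.union F'.fv_finite).exists_notMem
    exact .pure F F' hF hF' x hx (h.fill (.var k x)).relRed
  · obtain ⟨x, hx⟩ := (((G.fv_finite.union G'.fv_finite).union E.fv_finite).union
      E'.fv_finite).exists_notMem
    exact .delim G G' E E' hE hE' x hx (hG.fill (.var k x)).relRed (hR.fill (.var k x)).relRed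

theorem Rel.rnf_value {k : ℕ} {v v' : Value} (h : Rel k v.toTm v'.toTm) :
    RNF (RelRed k) v.toTm v'.toTm := by
  obtain ⟨x, hx⟩ := (v.toTm.fv_finite.union v'.toTm.fv_finite).exists_notMem
  refine .value v v' x hx ?_
  cases v <;> cases v' <;> cases h
  · exact (Rel.refl k _).relRed
  · rename_i hb; exact (hb.inst (.var k x)).relRed

theorem Rel.rnf_of_normal {k : ℕ} {s t : Tm} (h : Rel k s t) (hs : ∀ u, ¬ Red s u) :
    ∃ t', Eval t t' ∧ RNF (RelRed k) s t' := by
  have hv := h.view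
  have es := View.spec_of s
  have et := View.spec_of t
  generalize View.of s = a at hv es
  generalize View.of t = c at hv et
  clear h
  cases hv with
  | val h =>
    simp only [View.Spec] at es et
    subst es et
    exact ⟨_, .of_normal (normal_value _), h.rnf_value⟩
  | stuck x hF h =>
    simp only [View.Spec] at es et
    subst es et
    exact ⟨_, .of_normal (normal_fill_stuck _ _ _), .openStuck _ _ _ _ _ hF.ctxRel h.rnf_value⟩
  | @control E E' b b' hE h =>
    obtain ⟨pE, rfl⟩ := es
    obtain ⟨pE', rfl⟩ := et
    obtain ⟨k', hk'⟩ := ((E.fill (.shift b)).fv_finite.union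
      (E'.fill (.shift b')).fv_finite).exists_notMem
    refine ⟨_, .of_normal (normal_fill_shift pE' _), .control_inst pE pE' hk' ?_⟩
    exact (Rel.reset (h.inst (.lam (RelCtx.appR (.var k k') hE).body))).relRed
  | step _ => exact absurd es (hs _)
  | @expand G G' v v' hG h =>
    simp only [View.Spec] at es et
    subst es
    -- The right-hand context is split at the inner of its two resets, which leaves the surplus one
    -- in the outer part.
    have e : G'.fill (.reset (.reset (.app (.var k) v'.toTm))) =
        ((G'.comp (.reset .hole)).comp (.reset .hole)).fill (.app (.var k) v'.toTm) := by
      simp only [EvalCtx.fill_comp, EvalCtx.fill]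
    rw [e] at et
    refine ⟨_, .head et (.of_normal (normal_fill_stuck _ _ _)),
      .openStuck _ _ _ _ _ ?_ h.rnf_value⟩
    obtain ⟨x, hx⟩ := (((G.fv_finite.union (G'.comp (.reset .hole)).fv_finite).union
      EvalCtx.hole.fv_finite).union EvalCtx.hole.fv_finite).exists_notMem
    -- The outer parts give `G[x]` against `G'[⟨x⟩]`, which reduces to `G'[x]`. This is why `RelRed`
    -- allows reduction on the right.
    refine .delim _ _ _ _ trivial trivial x hx ⟨G'.fill (.var x), ?_, hG.fill (.var k x)⟩
      (Rel.refl k _).relRed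
    rw [EvalCtx.fill_comp]
    exact .single (.reset G' (.var x))

/-- Among the cases of `RelView`, only `step` has a reducing left side; the extra step on the right
occurs when the left is already stuck. -/
theorem Rel.red {k : ℕ} {s s' t : Tm} (h : Rel k s t) (hs : Red s s') :
    ∃ t', Red t t' ∧ Rel k s' t' := by
  have hv := h.view
  have et := View.spec_of t
  rw [View.red_iff.1 hs] at hv
  generalize View.of t = c at hv et
  cases hv with
  | step h => exact ⟨_, et, h⟩

theorem Rel.eval {k : ℕ} {s s' t : Tm} (h : Rel k s t) (hs : Eval s s') :
    ∃ t', Eval t t' ∧ RNF (RelRed k) s' t' := by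
  obtain ⟨hs, hn⟩ := hs
  induction hs using Relation.ReflTransGen.head_induction_on generalizing t with
  | refl => exact h.rnf_of_normal hn
  | head hr _ ih =>
    obtain ⟨t₁, ht, h₁⟩ := h.red hr
    obtain ⟨t', ht', hR⟩ := ih h₁
    exact ⟨t', .head ht ht', hR⟩

/-- Each step on the left is matched by a step on the right, which by determinism is the next one of
the given evaluation; so the left cannot run longer. -/
theorem Rel.eval_converges {k : ℕ} {s t t' : Tm} (h : Rel k s t) (ht : Eval t t') :
    ∃ s', Eval s s' := by
  obtain ⟨ht, hn⟩ := ht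
  induction ht using Relation.ReflTransGen.head_induction_on generalizing s with
  | refl =>
    refine ⟨s, .of_normal fun u hu => ?_⟩
    obtain ⟨t₁, ht, -⟩ := h.red hu
    exact hn _ ht
  | head hr _ ih =>
    by_cases hs : ∃ u, Red s u
    · obtain ⟨u, hu⟩ := hs
      obtain ⟨t₁, ht, h₁⟩ := h.red hu
      rw [← hr.deterministic ht] at h₁
      obtain ⟨s', hs'⟩ := ih h₁
      exact ⟨s', .head hu hs'⟩
    · exact ⟨s, .of_normal fun u hu => hs ⟨u, hu⟩⟩

theorem RelRed.eval {k : ℕ} {s t s' : Tm} (h : RelRed k s t) (hs : Eval s s') :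
    ∃ t', Eval t t' ∧ RNF (RelRed k) s' t' := by
  obtain ⟨u, hu, h⟩ := h
  obtain ⟨t', ht', hR⟩ := h.eval hs
  exact ⟨t', ⟨hu.trans ht'.1, ht'.2⟩, hR⟩

/-- Once the left side is known to terminate, the forward simulation applies, and uniqueness of
normal forms identifies its result with `t'`. -/
theorem RelRed.eval_flip {k : ℕ} {s t t' : Tm} (h : RelRed k s t) (ht : Eval t t') :
    ∃ s', Eval s s' ∧ RNF (RelRed k) s' t' := by
  obtain ⟨s', hs'⟩ : ∃ s', Eval s s' := by
    obtain ⟨u, hu, h⟩ := h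
    exact h.eval_converges (.of_reds hu ht)
  obtain ⟨t'', ht'', hR⟩ := h.eval hs'
  rw [← ht.deterministic ht'']
  exact ⟨s', hs', hR⟩

/-- Normal forms are refined bisimilar if they are related by `RNF (RelRed k)`. -/
theorem RBisim.of_rnf {k : ℕ} {t₀ t₁ : Tm} (h₀ : ∀ u, ¬ Red t₀ u) (h₁ : ∀ u, ¬ Red t₁ u)
    (h : RNF (RelRed k) t₀ t₁) : RBisim t₀ t₁ := by
  -- Being normal, the added pair evaluates only to itself, so its bisimulation clause is `h`.
  let R : Tm → Tm → Prop := fun s t => (s = t₀ ∧ t = t₁) ∨ RelRed k s t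
  have hR : ∀ s t, RelRed k s t → R s t := fun s t => Or.inr
  refine ⟨R, ⟨?_, ?_⟩, .inl ⟨rfl, rfl⟩⟩
  · rintro s t s' (⟨rfl, rfl⟩ | hst) hs
    · rw [hs.eq_of_normal h₀]
      exact ⟨t, .of_normal h₁, h.mono hR⟩
    · obtain ⟨t', ht', hr⟩ := hst.eval hs
      exact ⟨t', ht', hr.mono hR⟩
  · rintro t s t' (⟨rfl, rfl⟩ | hst) ht
    · rw [ht.eq_of_normal h₁]
      exact ⟨s, .of_normal h₀, (h.mono hR).flip⟩
    · obtain ⟨s', hs', hr⟩ := hst.eval_flip ht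
      exact ⟨s', hs', (hr.mono hR).flip⟩

/-- Only the head occurrence of `k'` is replaced. In the application `V` is the continuation `λy.⟨j
y⟩` of the empty context. -/
theorem subst_Lam_reset_app_fill {E : EvalCtx} {k' x : ℕ} (hk' : k' ∉ E.fv) (hx : x ∉ E.fv)
    (hxk' : x ≠ k') (V : Tm) :
    (Lam x (.reset (.app (.var k') (E.fill (.var x))))).subst k' V =
      .lam (.reset (.app (V.rename Nat.succ) ((E.rename Nat.succ).fill (.var 0)))) := by
  rw [← EvalCtx.abstr_fill hx]
  simp only [Lam, abstr, subst, Tm.rename, Tm.bind, if_neg hxk'.symm, Tm.up, if_true]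
  congr 3
  rw [bind_rename, rename_eq_bind]
  refine bind_congr fun n hn => ?_
  rw [EvalCtx.fv_fill] at hn
  by_cases hnx : n = x
  · simp [hnx, Tm.up]
  · have hnE : n ∈ E.fv := hn.resolve_right hnx
    have : n ≠ k' := by rintro rfl; exact hk' hnE
    simp [hnx, Tm.up, this, Tm.rename]

theorem rbisim_shift {E : EvalCtx} {t : Tm} {k k' x : ℕ} (hE : E.IsPure)
    (hk' : k' ∉ E.fv ∪ t.fv) (hx : x ∉ E.fv) (hxk' : x ≠ k') :
    RBisim (E.fill (Shift k t))
      (Shift k' (t.subst k (Lam x (.reset (.app (.var k') (E.fill (.var x))))))) := by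
  -- `j` serves both as the fresh continuation variable of the refined rule and as the index of
  -- `Rel`.
  obtain ⟨j, hj⟩ := ((E.fill (Shift k t)).fv_finite.union (EvalCtx.hole.fill
    (Shift k' (t.subst k (Lam x (.reset (.app (.var k') (E.fill (.var x)))))))).fv_finite
    ).exists_notMem
  refine RBisim.of_rnf (k := j) (normal_fill_shift hE _)
    (normal_fill_shift (E := .hole) trivial _)
    (RNF.control_inst (E₁ := .hole) hE trivial hj (Rel.relRed ?_))
  rw [abstr_inst, abstr_inst]
  have e : ∀ V : Tm,
      (t.subst k (Lam x (.reset (.app (.var k') (E.fill (.var x)))))).subst k' V =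
      t.subst k (.lam (.reset (.app (V.rename Nat.succ)
        ((E.rename Nat.succ).fill (.var 0))))) := by
    intro V
    rw [← subst_Lam_reset_app_fill (fun h => hk' (.inl h)) hx hxk' V]
    generalize Lam x (.reset (.app (.var k') (E.fill (.var x)))) = W
    simp only [subst]
    rw [bind_bind]
    refine bind_congr fun n hn => ?_
    have : n ≠ k' := by rintro rfl; exact hk' (.inr hn)
    by_cases hnk : n = k <;> simp [hnk, Tm.bind, this]
  rw [e]
  -- Both sides now substitute into the same `t`; the images of `k` differ by one use of `expand`
  -- under the binder.
  refine .reset (Rel.bind_self t fun n => ?_)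
  by_cases hn : n = k
  · simp only [hn, if_true]
    exact .lam (.expand (.refl _ _))
  · simp only [if_neg hn]
    exact .var _ _

/-! ### The plain bisimilarity -/

theorem not_eval_Omega (t : Tm) : ¬ Eval Omega t := by
  have hΩ : Red Omega Omega := View.red_iff.2 rfl
  rintro ⟨h, hn⟩
  have ht : t = Omega := by
    clear hn
    induction h with
    | refl => rfl
    | tail _ hr ih => subst ih; exact hr.deterministic hΩ
  exact hn _ (ht ▸ hΩ)

/-- By uniqueness of views, only the control rule can apply, and with these very contexts. -/
theorem NF.ctxRel_of_shift {R : Tm → Tm → Prop} {E₀ E₁ : EvalCtx} (h₀ : E₀.IsPure)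
    (h₁ : E₁.IsPure) {b₀ b₁ : Tm} (h : NF R (E₀.fill (.shift b₀)) (E₁.fill (.shift b₁))) :
    CtxRel R E₀ E₁ := by
  generalize hs : E₀.fill (.shift b₀) = s at h
  generalize ht : E₁.fill (.shift b₁) = t at h
  have vs := View.of_fill_shift h₀ b₀
  have vt := View.of_fill_shift h₁ b₁
  rw [hs] at vs
  rw [ht] at vt
  cases h with
  | value v₀ v₁ => rw [View.of_toTm] at vs; cases vs
  | openStuck F₀ F₁ x v₀ v₁ => rw [View.of_fill_stuck] at vs; cases vs
  | control G₀ G₁ g₀ g₁ k t₀ t₁ hE ht =>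
    rw [Shift, View.of_fill_shift g₀] at vs
    rw [Shift, View.of_fill_shift g₁] at vt
    cases vs
    cases vt
    exact hE

/-- The bodies play no role: the contexts alone already tell the two terms apart. -/
theorem not_bisim_shift {z : ℕ} (b₀ b₁ : Tm) :
    ¬ Bisim ((EvalCtx.appR (.lam (abstr z Omega)) .hole).fill (.shift b₀)) (.shift b₁) := by
  rintro ⟨R, ⟨h₁, h₂⟩, h⟩
  obtain ⟨t', ht', hR⟩ := h₁ _ _ _ h (.of_normal (normal_fill_shift (by trivial) b₀))
  rw [ht'.eq_of_normal (normal_fill_shift (E := .hole) trivial b₁)] at hR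
  have hE := NF.ctxRel_of_shift (E₀ := .appR _ .hole) (E₁ := .hole) trivial trivial hR
  generalize hG : EvalCtx.hole = G at hE
  generalize hF : EvalCtx.appR (.lam (abstr z Omega)) G = F at hE
  cases hE with
  | delim F₀ F₁ E₀ E₁ =>
    -- The empty context contains no reset, so the delimited case is impossible.
    exact EvalCtx.not_isPure_comp_reset F₁ E₁ (hG ▸ trivial)
  | pure _ _ _ _ x hx hE =>
    subst hG hF
    -- The inverse simulation is the one that fails: `x` is a value, so `(λz.Ω) x` would have to
    -- terminate.
    obtain ⟨u, hu, -⟩ := h₂ _ _ _ hE (.of_normal (normal_value (.var x)))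
    have hr := Red.beta .hole (abstr z Omega) (.var x)
    exact not_eval_Omega u (hu.of_red hr)

end ShiftReset

open ShiftReset Tm in
/-- The first part is the equivalence for the refined bisimilarity. The second part says that it
fails for the plain bisimilarity when the pure context is `(λz.Ω) □`. -/
theorem propositionp :
    (∀ (E : EvalCtx) (t : Tm) (k k' x : ℕ), E.IsPure →
      k' ∉ E.fv ∪ t.fv → x ∉ E.fv → x ≠ k' →
      RBisim (E.fill (Shift k t))
        (Shift k' (t.subst k (Lam x (.reset (.app (.var k') (E.fill (.var x)))))))) ∧
    (∀ (E : EvalCtx) (t : Tm) (k k' x z : ℕ),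
      E = .appR (.lam (abstr z Omega)) .hole →
      k' ∉ E.fv ∪ t.fv → x ∉ E.fv → x ≠ k' →
      ¬ Bisim (E.fill (Shift k t))
        (Shift k' (t.subst k (Lam x (.reset (.app (.var k') (E.fill (.var x)))))))) := by
  refine ⟨fun E t k k' x hE hk' hx hxk' => rbisim_shift hE hk' hx hxk', ?_⟩
  rintro E t k k' x z rfl - - -
  exact not_bisim_shift _ _
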